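/- Let $K$ be a field, $n\ge 2$, $a\in K\setminus\{0,-1\}$ and $d=\frac{1}{a+1}$. Let $L=(L_1,L_2,\dots)$ be a sequence of natural numbers with $L_1=n$ and $L_{j+1}-L_j\in\{n,n+1\}$ for all $j\ge 1$. Consider matrices over $K$ indexed by $\mathbb{N}_0\times\mathbb{N}_0$ whose rows have only finitely many non-zero entries, let $E_j$ be the row vector with $(E_j)_i=\delta_{ij}$, let $Y$ be the matrix with rows $Y_{i,*}=E_{i+1}$, let $\widetilde M=M(L)$ be the matrix with rows $$ \widetilde M_{j,*}=\begin{cases} E_0-E_1, & j<L_1,\\ d^k(E_0-E_1), & L_k<j<L_{k+1},\\ d^kE_0-d^{k-1}E_1+aE_{L_k+1}, & j=L_k,\end{cases} $$ and set $M=\widetilde M+Y$. Let $\tau_M\colon K[y]\otimes K[x]\to K[x]\otimes K[y]$ be the linear map with $\tau_M(y^r\otimes x^i)=\sum_j (M^i)_{rj}\,x^{r+i-j}\otimes y^j$. A twisting map of $K[x]$ with $K[y]$ is a linear map $\tau\colon K[y]\otimes K[x]\to K[x]\otimes K[y]$ with $\tau(1\otimes f)=f\otimes 1$, $\tau(g\otimes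 1)=1\otimes g$, $\tau\circ(\mathrm{id}\otimes\mu_{K[x]})=(\mu_{K[x]}\otimes \mathrm{id})(\mathrm{id}\otimes\tau)(\tau\otimes \mathrm{id})$ and $\tau\circ(\mu_{K[y]}\otimes \mathrm{id})=(\mathrm{id}\otimes\mu_{K[y]})(\tau\otimes \mathrm{id})(\mathrm{id}\otimes\tau)$, where $\mu$ denotes multiplication; it is graded if each $\tau(y^r\otimes x^i)$ is a linear combination of the elements $x^{i+r-j}\otimes y^j$, $0\le j\le i+r$. Call $L$ quasi-balanced if $L_r-1\le L_j+L_{r-j}\le L_r$ for all $0<j<r$. Then each of the following three conditions holds if and only if $L$ is quasi-balanced: 1. $\tau_M$ is a graded twisting map; 2. $M_{0j}=\delta_{0j}$, $M_{kj}=0$ for $j>k+1$, and $Y^kM=\sum_{j=0}^{k+1}M_{kj}M^{k+1-j}Y^j$ for all $k\ge 0$; 3. there is a graded twisting map $\tau$ of $K[x]$ with $K[y]$ such that $\tau(y^k\otimes x)=\sum_{j=0}^{k+1}M_{kj}\,x^{k+1-j}\otimes y^j$ for all $k\ge 0$. If $L$ is quasi-balanced, then $\tau_M(y^k\otimes x)=\sum_{j=0}^{k+1}M_{kj}\,x^{k+1-j}\otimes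 y^j$ for all $k\ge 0$, and the multiplication $(\mu_{K[x]}\otimes\mu_{K[y]})\circ(\mathrm{id}\otimes\tau_M\otimes\mathrm{id})$ on $K[x]\otimes K[y]$ is a twisted tensor product $B(a,L)$: it is associative with unit $1\otimes 1$, the canonical maps from $K[x]$ and $K[y]$ are algebra maps, $(f\otimes 1)(1\otimes g)=f\otimes g$, and $(1\otimes y^k)(x\otimes 1)=\sum_{j=0}^{k+1}M_{kj}\,x^{k+1-j}\otimes y^j$ for all $k\ge 0$. -/

import Mathlib

open scoped TensorProduct Polynomial

/-! ### Twisting maps and twisted tensor products -/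

section Twisting

variable {K A B : Type*} [Field K] [Ring A] [Algebra K A] [Ring B] [Algebra K B]

/-- A twisting map of `A` with `B`: a linear map `τ : B ⊗ A → A ⊗ B` compatible with the units and
the multiplications of `A` and `B`. -/
structure IsTwistingMap (τ : B ⊗[K] A →ₗ[K] A ⊗[K] B) : Prop where
  /-- `τ(1 ⊗ a) = a ⊗ 1` -/
  one_tmul : ∀ a : A, τ ((1 : B) ⊗ₜ[K] a) = a ⊗ₜ[K] (1 : B)
  /-- `τ(b ⊗ 1) = 1 ⊗ b` -/
  tmul_one : ∀ b : B, τ (b ⊗ₜ[K] (1 : A)) = (1 : A) ⊗ₜ[K] b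
  /-- `τ ∘ (B ⊗ μ_A) = (μ_A ⊗ B) ∘ (A ⊗ τ) ∘ (τ ⊗ A)` -/
  tmul_mul :
    τ ∘ₗ LinearMap.lTensor B (LinearMap.mul' K A) ∘ₗ (TensorProduct.assoc K B A A).toLinearMap =
      LinearMap.rTensor B (LinearMap.mul' K A) ∘ₗ (TensorProduct.assoc K A A B).symm.toLinearMap ∘ₗ
        LinearMap.lTensor A τ ∘ₗ (TensorProduct.assoc K A B A).toLinearMap ∘ₗ
        LinearMap.rTensor A τ
  /-- `τ ∘ (μ_B ⊗ A) = (A ⊗ μ_B) ∘ (τ ⊗ B) ∘ (B ⊗ τ)` -/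
  mul_tmul :
    τ ∘ₗ LinearMap.rTensor A (LinearMap.mul' K B) =
      LinearMap.lTensor A (LinearMap.mul' K B) ∘ₗ (TensorProduct.assoc K A B B).toLinearMap ∘ₗ
        LinearMap.rTensor B τ ∘ₗ (TensorProduct.assoc K B A B).symm.toLinearMap ∘ₗ
        LinearMap.lTensor B τ ∘ₗ (TensorProduct.assoc K B B A).toLinearMap

/-- A bilinear multiplication on `A ⊗ B` is a twisted tensor product of `A` with `B` if it is
associative and unital, the canonical maps `A → A ⊗ B` and `B → A ⊗ B` are algebra maps and
`i_A(a) i_B(b) = a ⊗ b`. -/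
structure IsTwistedTensorProduct (mul : A ⊗[K] B →ₗ[K] A ⊗[K] B →ₗ[K] A ⊗[K] B) : Prop where
  assoc : ∀ u v w, mul (mul u v) w = mul u (mul v w)
  one_mul : ∀ u, mul ((1 : A) ⊗ₜ[K] (1 : B)) u = u
  mul_one : ∀ u, mul u ((1 : A) ⊗ₜ[K] (1 : B)) = u
  inclA_mul : ∀ a a' : A,
    mul (a ⊗ₜ[K] (1 : B)) (a' ⊗ₜ[K] (1 : B)) = (a * a') ⊗ₜ[K] (1 : B)
  inclB_mul : ∀ b b' : B,
    mul ((1 : A) ⊗ₜ[K] b) ((1 : A) ⊗ₜ[K] b') = (1 : A) ⊗ₜ[K] (b * b')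
  inclA_mul_inclB : ∀ (a : A) (b : B),
    mul (a ⊗ₜ[K] (1 : B)) ((1 : A) ⊗ₜ[K] b) = a ⊗ₜ[K] b

/-- The multiplication `(μ_A ⊗ μ_B) ∘ (A ⊗ τ ⊗ B)` on `A ⊗ B`. -/
noncomputable def twistedMul (τ : B ⊗[K] A →ₗ[K] A ⊗[K] B) :
    A ⊗[K] B →ₗ[K] A ⊗[K] B →ₗ[K] A ⊗[K] B :=
  TensorProduct.curry
    (TensorProduct.map (LinearMap.mul' K A) (LinearMap.mul' K B) ∘ₗ
      (TensorProduct.assoc K (A ⊗[K] A) B B).toLinearMap ∘ₗ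
      LinearMap.rTensor B
        ((TensorProduct.assoc K A A B).symm.toLinearMap ∘ₗ LinearMap.lTensor A τ ∘ₗ
          (TensorProduct.assoc K A B A).toLinearMap) ∘ₗ
      (TensorProduct.assoc K (A ⊗[K] B) A B).symm.toLinearMap)

end Twisting

/-! ### Infinite matrices with finite rows -/

section InfMat

variable {K : Type*} [Field K]

/-- Matrices indexed by `ℕ × ℕ` all of whose rows have finitely many non-zero entries; `A i` is the
`i`-th row and `A i j` is the entry `(i, j)`. -/
abbrev InfMat (K : Type*) [Field K] : Type _ := ℕ → ℕ →₀ K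

/-- The matrix product, `(A B)_{i,*} = ∑_k A_{ik} B_{k,*}`. -/
noncomputable def infMul (A B : InfMat K) : InfMat K :=
  fun i => (A i).sum fun k c => c • B k

/-- The powers of a matrix for the matrix product. -/
noncomputable def infPow (A : InfMat K) : ℕ → InfMat K
  | 0 => fun i => Finsupp.single i 1
  | m + 1 => infMul (infPow A m) A

/-- The shift matrix `Y`, with `Y_{i,i+1} = 1` and all other entries zero. -/
noncomputable def shiftY (K : Type*) [Field K] : InfMat K :=
  fun i => Finsupp.single (i + 1) 1

/-- The conditions `M_{0j} = δ_{0j}`, `M_{kj} = 0` for `j > k + 1`, and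
`Y^k M = ∑_{j=0}^{k+1} M_{kj} M^{k+1-j} Y^j` for all `k`. -/
structure IsGradedTwistingMatrix (M : InfMat K) : Prop where
  row_zero : M 0 = Finsupp.single 0 1
  hessenberg : ∀ k j, k + 1 < j → M k j = 0
  shift_mul : ∀ k, infMul (infPow (shiftY K) k) M =
    ∑ j ∈ Finset.range (k + 2), M k j • infMul (infPow M (k + 1 - j)) (infPow (shiftY K) j)

end InfMat

/-! ### Graded twisting maps of `K[x]` with `K[y]`

Both polynomial rings are `K[X]`; in `τ : K[y] ⊗ K[x] → K[x] ⊗ K[y]` the roles are given by the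
position of the factor. -/

section Graded

variable {K : Type*} [Field K]

/-- `τ` is a twisting map such that every `τ(y^r ⊗ x^i)` is a linear combination of the elements
`x^{i+r-j} ⊗ y^j`, `0 ≤ j ≤ i + r`. -/
structure IsGradedTwistingMap (τ : K[X] ⊗[K] K[X] →ₗ[K] K[X] ⊗[K] K[X]) : Prop where
  isTwistingMap : IsTwistingMap τ
  graded : ∀ r i : ℕ, ∃ c : ℕ → K,
    τ ((Polynomial.X ^ r) ⊗ₜ[K] (Polynomial.X ^ i)) =
      ∑ j ∈ Finset.range (i + r + 1),
        c j • ((Polynomial.X ^ (i + r - j) : K[X]) ⊗ₜ[K] (Polynomial.X ^ j : K[X]))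

/-- `M` is the matrix of `τ`: `τ(y^k ⊗ x) = ∑_{j=0}^{k+1} M_{kj} x^{k+1-j} ⊗ y^j` for all `k`. -/
def HasMatrix (τ : K[X] ⊗[K] K[X] →ₗ[K] K[X] ⊗[K] K[X]) (M : InfMat K) : Prop :=
  ∀ k : ℕ, τ ((Polynomial.X ^ k) ⊗ₜ[K] Polynomial.X) =
    ∑ j ∈ Finset.range (k + 2),
      M k j • ((Polynomial.X ^ (k + 1 - j) : K[X]) ⊗ₜ[K] (Polynomial.X ^ j : K[X]))

/-- The linear map `τ_M` with `τ_M(y^r ⊗ x^i) = ∑_j (M^i)_{rj} x^{r+i-j} ⊗ y^j`. (If `M_{kj} = 0`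
for `j > k + 1`, only `j ≤ r + i` contribute.) -/
noncomputable def twistOfMatrix (M : InfMat K) : K[X] ⊗[K] K[X] →ₗ[K] K[X] ⊗[K] K[X] :=
  TensorProduct.lift
    ((Polynomial.basisMonomials K).constr K fun r =>
      (Polynomial.basisMonomials K).constr K fun i =>
        (infPow M i r).sum fun j c =>
          c • ((Polynomial.X ^ (r + i - j) : K[X]) ⊗ₜ[K] (Polynomial.X ^ j : K[X])))

end Graded

/-! ### The sequences and the matrices `M(L)`

A sequence `L_1, L_2, …` is a function `L : ℕ → ℕ`; the value `L 0` is never used. -/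

/-- `L_1 = n` and `L_{j+1} - L_j ∈ {n, n+1}` for all `j ≥ 1`. -/
def IsDeltaSeq (n : ℕ) (L : ℕ → ℕ) : Prop :=
  L 1 = n ∧ ∀ j, 1 ≤ j → L (j + 1) = L j + n ∨ L (j + 1) = L j + (n + 1)

/-- `L_r - 1 ≤ L_j + L_{r-j} ≤ L_r` for all `0 < j < r`. -/
def IsQuasiBalanced (L : ℕ → ℕ) : Prop :=
  ∀ r j, 0 < j → j < r → L r ≤ L j + L (r - j) + 1 ∧ L j + L (r - j) ≤ L r

/-- The number of indices `1 ≤ k ≤ j` with `L_k ≤ j`. For a sequence as above with `n ≥ 1` this is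
the `k` with `L_k ≤ j < L_{k+1}`, and it is `0` if `j < L_1`. -/
def levelOf (L : ℕ → ℕ) (j : ℕ) : ℕ :=
  ((Finset.Icc 1 j).filter fun k => L k ≤ j).card

section MatrixOfSeq

variable {K : Type*} [Field K]

/-- The matrix `M(L)`, with `d = 1 / (a + 1)`; its rows are computed in `matOfSeq_of_lt`,
`matOfSeq_of_between` and `matOfSeq_of_eq`. -/
noncomputable def matOfSeq (a : K) (L : ℕ → ℕ) : InfMat K := fun j =>
  if 1 ≤ levelOf L j ∧ L (levelOf L j) = j then
    Finsupp.single 0 ((1 / (a + 1)) ^ levelOf L j)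
      - Finsupp.single 1 ((1 / (a + 1)) ^ (levelOf L j - 1)) + Finsupp.single (j + 1) a
  else
    (1 / (a + 1)) ^ levelOf L j • (Finsupp.single 0 1 - Finsupp.single 1 1)

theorem IsDeltaSeq.strictMono {n : ℕ} {L : ℕ → ℕ} (hn : 1 ≤ n) (hL : IsDeltaSeq n L)
    {i j : ℕ} (hi : 1 ≤ i) (hij : i < j) : L i < L j := by
  induction j, hij using Nat.le_induction with
  | base =>
    change L i < L (i + 1)
    rcases hL.2 i hi with h | h <;> omega
  | succ m hm ih => rcases hL.2 m (by omega) with h | h <;> omega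

theorem IsDeltaSeq.le_apply {n : ℕ} {L : ℕ → ℕ} (hn : 1 ≤ n) (hL : IsDeltaSeq n L)
    {k : ℕ} (hk : 1 ≤ k) : k ≤ L k := by
  induction k, hk using Nat.le_induction with
  | base => rw [hL.1]; exact hn
  | succ m hm ih => rcases hL.2 m hm with h | h <;> omega

theorem IsDeltaSeq.levelOf_eq {n : ℕ} {L : ℕ → ℕ} (hn : 1 ≤ n) (hL : IsDeltaSeq n L)
    {j k : ℕ} (h1 : 1 ≤ k → L k ≤ j) (h2 : j < L (k + 1)) : levelOf L j = k := by
  have : (Finset.Icc 1 j).filter (fun i => L i ≤ j) = Finset.Icc 1 k := by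
    ext i
    simp only [Finset.mem_filter, Finset.mem_Icc]
    constructor
    · rintro ⟨⟨hi, -⟩, hij⟩
      refine ⟨hi, ?_⟩
      by_contra hc
      rcases Nat.lt_or_ge (k + 1) i with h | h
      · have := hL.strictMono hn (by omega) h
        omega
      · have : i = k + 1 := by omega
        subst this
        omega
    · rintro ⟨hi, hik⟩
      have hk := h1 (by omega)
      have hle : L i ≤ L k := by
        rcases Nat.lt_or_ge i k with h | h
        · exact (hL.strictMono hn hi h).le
        · rw [le_antisymm hik h]
      have := hL.le_apply hn hi
      omega
  rw [levelOf, this, Nat.card_Icc]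
  omega

/-- The rows above `L_1` are `E_0 - E_1`. -/
theorem matOfSeq_of_lt {n : ℕ} {L : ℕ → ℕ} (hn : 1 ≤ n) (hL : IsDeltaSeq n L) (a : K)
    {j : ℕ} (hj : j < L 1) :
    matOfSeq a L j = Finsupp.single 0 1 - Finsupp.single 1 1 := by
  have h := hL.levelOf_eq hn (j := j) (k := 0) (by omega) hj
  simp [matOfSeq, h]

/-- The rows strictly between `L_k` and `L_{k+1}` are `d^k (E_0 - E_1)`. -/
theorem matOfSeq_of_between {n : ℕ} {L : ℕ → ℕ} (hn : 1 ≤ n) (hL : IsDeltaSeq n L) (a : K)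
    {j k : ℕ} (h1 : L k < j) (h2 : j < L (k + 1)) :
    matOfSeq a L j = (1 / (a + 1)) ^ k • (Finsupp.single 0 1 - Finsupp.single 1 1) := by
  have h := hL.levelOf_eq hn (j := j) (k := k) (fun _ => h1.le) h2
  have h' : ¬ (1 ≤ k ∧ L k = j) := by omega
  simp only [matOfSeq, h, if_neg h']

/-- The row `L_k` is `d^k E_0 - d^(k-1) E_1 + a E_{L_k + 1}`. -/
theorem matOfSeq_of_eq {n : ℕ} {L : ℕ → ℕ} (hn : 1 ≤ n) (hL : IsDeltaSeq n L) (a : K)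
    {k : ℕ} (hk : 1 ≤ k) :
    matOfSeq a L (L k) = Finsupp.single 0 ((1 / (a + 1)) ^ k)
      - Finsupp.single 1 ((1 / (a + 1)) ^ (k - 1)) + Finsupp.single (L k + 1) a := by
  have h := hL.levelOf_eq hn (j := L k) (k := k) (fun _ => le_rfl)
    (hL.strictMono hn hk (Nat.lt_succ_self k))
  simp only [matOfSeq, h]
  rw [if_pos ⟨hk, trivial⟩]

end MatrixOfSeq

/-!
In a graded twisted tensor product `y^k x = ∑_j M_{kj} x^{k+1-j} y^j`, and moving a power of `y`
past a power of `x` one factor at a time shows that `M` determines the twisting map and that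
associativity amounts to the relations `Y^k M = ∑_j M_{kj} M^{k+1-j} Y^j`.

Put `w_j = d^{c(j)}` with `c(j) = #{r ≥ 1 : L_r < j}`. The rows of `M(L)` then all have the shape
`w_{j+1} E_0 - w_j E_1 + (w_j / w_{j+1}) E_{j+1}`: the rescaled vector `w_j⁻¹ E_j` is sent to
`w_{j+1}⁻¹ E_{j+1} - E_1 + (w_{j+1} / w_j) E_0`, so the powers of `M` telescope. Comparing
coefficients of `E_0`, the relations become `w_{i+k} = w_i w_k (1 + R(i+k) - R(i) - R(k))`, where
`R(m)` is the sum of the ratios `w_{t+1} / w_t` for `t < m`; the coefficients of `E_1` and of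
`E_{i+k+1}` give nothing new. For `w = d^c` this reads `d^{-e} = 1 + (1 - d) e` with
`e = c(i) + c(k) - c(i+k)`. It holds for `e = 0` and `e = -1`, and fails for `e = 1` and `e = -2`
because `(d - 1)^2 ≠ 0`. As `k` grows from `0`, `e` starts at `0` and moves in steps of at most
one, so it has to stay in `{0, -1}`. Since `r ≤ c(j)` is equivalent to `L_r < j`, this says that
`L` is quasi-balanced.
-/

/-! ### The twisted multiplication -/

section TwistedMul

variable {K A B : Type*} [Field K] [Ring A] [Algebra K A] [Ring B] [Algebra K B]

section

variable (τ : B ⊗[K] A →ₗ[K] A ⊗[K] B)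

theorem twistedMul_tmul (a a' : A) (b b' : B) :
    twistedMul τ (a ⊗ₜ[K] b) (a' ⊗ₜ[K] b') =
      TensorProduct.map (LinearMap.mulLeft K a) (LinearMap.mulRight K b') (τ (b ⊗ₜ[K] a')) := by
  simp only [twistedMul, TensorProduct.curry_apply, LinearMap.comp_apply, LinearEquiv.coe_coe,
    TensorProduct.assoc_symm_tmul, LinearMap.rTensor_tmul, TensorProduct.assoc_tmul,
    LinearMap.lTensor_tmul]
  induction τ (b ⊗ₜ[K] a') with
  | zero => simp
  | tmul p q => simp
  | add p q hp hq => simp only [TensorProduct.tmul_add, TensorProduct.add_tmul, map_add, hp, hq]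

theorem twistedMul_tmul_one (a a' : A) (b : B) :
    twistedMul τ (a ⊗ₜ[K] b) (a' ⊗ₜ[K] 1) =
      LinearMap.rTensor B (LinearMap.mulLeft K a) (τ (b ⊗ₜ[K] a')) := by
  rw [twistedMul_tmul, LinearMap.mulRight_one, LinearMap.rTensor]

theorem twistedMul_one_tmul (a : A) (b b' : B) :
    twistedMul τ (1 ⊗ₜ[K] b) (a ⊗ₜ[K] b') =
      LinearMap.lTensor A (LinearMap.mulRight K b') (τ (b ⊗ₜ[K] a)) := by
  rw [twistedMul_tmul, LinearMap.mulLeft_one, LinearMap.lTensor]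

theorem twistedMul_one_tmul_tmul_one (b : B) (a : A) :
    twistedMul τ (1 ⊗ₜ[K] b) (a ⊗ₜ[K] 1) = τ (b ⊗ₜ[K] a) := by
  rw [twistedMul_tmul_one, LinearMap.mulLeft_one, LinearMap.rTensor_id_apply]

theorem twistedMul_rTensor_mulLeft (a : A) (u v : A ⊗[K] B) :
    twistedMul τ (LinearMap.rTensor B (LinearMap.mulLeft K a) u) v =
      LinearMap.rTensor B (LinearMap.mulLeft K a) (twistedMul τ u v) := by
  suffices twistedMul τ ∘ₗ LinearMap.rTensor B (LinearMap.mulLeft K a) =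
      (twistedMul τ).compr₂ (LinearMap.rTensor B (LinearMap.mulLeft K a)) from
    LinearMap.congr_fun₂ this u v
  refine TensorProduct.ext' fun p q => TensorProduct.ext' fun s t => ?_
  simp only [LinearMap.comp_apply, LinearMap.compr₂_apply, LinearMap.rTensor_tmul, twistedMul_tmul,
    LinearMap.mulLeft_apply, LinearMap.mulLeft_mul, ← LinearMap.rTensor_comp_map]

theorem twistedMul_lTensor_mulRight (b : B) (u v : A ⊗[K] B) :
    twistedMul τ u (LinearMap.lTensor A (LinearMap.mulRight K b) v) =
      LinearMap.lTensor A (LinearMap.mulRight K b) (twistedMul τ u v) := by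
  suffices (twistedMul τ).compl₂ (LinearMap.lTensor A (LinearMap.mulRight K b)) =
      (twistedMul τ).compr₂ (LinearMap.lTensor A (LinearMap.mulRight K b)) from
    LinearMap.congr_fun₂ this u v
  refine TensorProduct.ext' fun p q => TensorProduct.ext' fun s t => ?_
  simp only [LinearMap.compl₂_apply, LinearMap.compr₂_apply, LinearMap.lTensor_tmul,
    twistedMul_tmul, LinearMap.mulRight_apply, LinearMap.mulRight_mul, ← LinearMap.lTensor_comp_map,
    LinearMap.comp_apply]

theorem rTensor_mul'_lTensor_tmul (u : A ⊗[K] B) (a : A) :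
    LinearMap.rTensor B (LinearMap.mul' K A) ((TensorProduct.assoc K A A B).symm
      (LinearMap.lTensor A τ (TensorProduct.assoc K A B A (u ⊗ₜ[K] a)))) =
    twistedMul τ u (a ⊗ₜ[K] 1) := by
  induction u with
  | zero => simp
  | add u v hu hv => simp only [TensorProduct.add_tmul, map_add, hu, hv, LinearMap.add_apply]
  | tmul p q =>
    rw [twistedMul_tmul_one, TensorProduct.assoc_tmul, LinearMap.lTensor_tmul]
    induction τ (q ⊗ₜ[K] a) with
    | zero => simp
    | tmul s t => simp
    | add s t hs ht => simp only [TensorProduct.tmul_add, map_add, hs, ht]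

theorem lTensor_mul'_rTensor_tmul (b : B) (u : A ⊗[K] B) :
    LinearMap.lTensor A (LinearMap.mul' K B) (TensorProduct.assoc K A B B
      (LinearMap.rTensor B τ ((TensorProduct.assoc K B A B).symm (b ⊗ₜ[K] u)))) =
    twistedMul τ (1 ⊗ₜ[K] b) u := by
  induction u with
  | zero => simp
  | add u v hu hv => simp only [TensorProduct.tmul_add, map_add, hu, hv]
  | tmul p q =>
    rw [twistedMul_one_tmul, TensorProduct.assoc_symm_tmul, LinearMap.rTensor_tmul]
    induction τ (b ⊗ₜ[K] p) with
    | zero => simp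
    | tmul s t => simp
    | add s t hs ht => simp only [TensorProduct.add_tmul, map_add, hs, ht]

end

namespace IsTwistingMap

variable {τ : B ⊗[K] A →ₗ[K] A ⊗[K] B}

theorem apply_tmul_mul (h : IsTwistingMap τ) (b : B) (a a' : A) :
    τ (b ⊗ₜ[K] (a * a')) = twistedMul τ (τ (b ⊗ₜ[K] a)) (a' ⊗ₜ[K] 1) := by
  simpa [rTensor_mul'_lTensor_tmul] using LinearMap.congr_fun h.tmul_mul ((b ⊗ₜ[K] a) ⊗ₜ[K] a')

theorem apply_mul_tmul (h : IsTwistingMap τ) (b b' : B) (a : A) :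
    τ ((b * b') ⊗ₜ[K] a) = twistedMul τ (1 ⊗ₜ[K] b) (τ (b' ⊗ₜ[K] a)) := by
  simpa [lTensor_mul'_rTensor_tmul] using LinearMap.congr_fun h.mul_tmul ((b ⊗ₜ[K] b') ⊗ₜ[K] a)

theorem twistedMul_lTensor_mulRight_tmul_one (h : IsTwistingMap τ) (u : A ⊗[K] B) (b : B) (a : A) :
    twistedMul τ (LinearMap.lTensor A (LinearMap.mulRight K b) u) (a ⊗ₜ[K] 1) =
      twistedMul τ u (τ (b ⊗ₜ[K] a)) := by
  induction u with
  | zero => simp only [map_zero, LinearMap.zero_apply]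
  | add u v hu hv => simp only [map_add, LinearMap.add_apply, hu, hv]
  | tmul p q =>
    calc twistedMul τ (LinearMap.lTensor A (LinearMap.mulRight K b) (p ⊗ₜ[K] q)) (a ⊗ₜ[K] 1)
      _ = LinearMap.rTensor B (LinearMap.mulLeft K p) (τ ((q * b) ⊗ₜ[K] a)) := by
        rw [LinearMap.lTensor_tmul, LinearMap.mulRight_apply, twistedMul_tmul_one]
      _ = twistedMul τ (p ⊗ₜ[K] q) (τ (b ⊗ₜ[K] a)) := by
        rw [h.apply_mul_tmul, ← twistedMul_rTensor_mulLeft, LinearMap.rTensor_tmul,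
          LinearMap.mulLeft_apply, mul_one]

theorem twistedMul_one_tmul_rTensor_mulLeft (h : IsTwistingMap τ) (b : B) (a : A) (v : A ⊗[K] B) :
    twistedMul τ (1 ⊗ₜ[K] b) (LinearMap.rTensor B (LinearMap.mulLeft K a) v) =
      twistedMul τ (τ (b ⊗ₜ[K] a)) v := by
  induction v with
  | zero => simp only [map_zero]
  | add u v hu hv => simp only [map_add, hu, hv]
  | tmul p q =>
    calc twistedMul τ (1 ⊗ₜ[K] b) (LinearMap.rTensor B (LinearMap.mulLeft K a) (p ⊗ₜ[K] q))
      _ = LinearMap.lTensor A (LinearMap.mulRight K q) (τ (b ⊗ₜ[K] (a * p))) := by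
        rw [LinearMap.rTensor_tmul, LinearMap.mulLeft_apply, twistedMul_one_tmul]
      _ = twistedMul τ (τ (b ⊗ₜ[K] a)) (p ⊗ₜ[K] q) := by
        rw [h.apply_tmul_mul, ← twistedMul_lTensor_mulRight, LinearMap.lTensor_tmul,
          LinearMap.mulRight_apply, one_mul]

theorem twistedMul_assoc_tmul (h : IsTwistingMap τ) (a a' a'' : A) (b b' b'' : B) :
    twistedMul τ (twistedMul τ (a ⊗ₜ[K] b) (a' ⊗ₜ[K] b')) (a'' ⊗ₜ[K] b'') =
      twistedMul τ (a ⊗ₜ[K] b) (twistedMul τ (a' ⊗ₜ[K] b') (a'' ⊗ₜ[K] b'')) := by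
  have inner : twistedMul τ (twistedMul τ (1 ⊗ₜ[K] b) (a' ⊗ₜ[K] b')) (a'' ⊗ₜ[K] 1) =
      twistedMul τ (1 ⊗ₜ[K] b) (twistedMul τ (a' ⊗ₜ[K] b') (a'' ⊗ₜ[K] 1)) := by
    rw [twistedMul_one_tmul, h.twistedMul_lTensor_mulRight_tmul_one, twistedMul_tmul_one,
      h.twistedMul_one_tmul_rTensor_mulLeft]
  have left_factor : a ⊗ₜ[K] b = LinearMap.rTensor B (LinearMap.mulLeft K a) (1 ⊗ₜ[K] b) := by
    rw [LinearMap.rTensor_tmul, LinearMap.mulLeft_apply, mul_one]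
  have right_factor :
      a'' ⊗ₜ[K] b'' = LinearMap.lTensor A (LinearMap.mulRight K b'') (a'' ⊗ₜ[K] 1) := by
    rw [LinearMap.lTensor_tmul, LinearMap.mulRight_apply, one_mul]
  rw [left_factor, right_factor]
  simp only [twistedMul_rTensor_mulLeft, twistedMul_lTensor_mulRight, inner]

theorem isTwistedTensorProduct (h : IsTwistingMap τ) :
    IsTwistedTensorProduct (twistedMul τ) where
  assoc u v w := by
    induction u with
    | zero => simp only [map_zero, LinearMap.zero_apply]
    | add p q hp hq => simp only [map_add, LinearMap.add_apply, hp, hq]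
    | tmul a b =>
    induction v with
    | zero => simp only [map_zero, LinearMap.zero_apply]
    | add p q hp hq => simp only [map_add, LinearMap.add_apply, hp, hq]
    | tmul a' b' =>
    induction w with
    | zero => simp only [map_zero]
    | add p q hp hq => simp only [map_add, hp, hq]
    | tmul a'' b'' => exact h.twistedMul_assoc_tmul a a' a'' b b' b''
  one_mul u := by
    induction u with
    | zero => simp
    | add p q hp hq => simp only [map_add, hp, hq]
    | tmul a b => simp [twistedMul_tmul, h.one_tmul]
  mul_one u := by
    induction u with
    | zero => simp
    | add p q hp hq => simp only [map_add, LinearMap.add_apply, hp, hq]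
    | tmul a b => simp [twistedMul_tmul, h.tmul_one]
  inclA_mul a a' := by simp [twistedMul_tmul, h.one_tmul]
  inclB_mul b b' := by simp [twistedMul_tmul, h.tmul_one]
  inclA_mul_inclB a b := by simp [twistedMul_tmul, h.one_tmul]

end IsTwistingMap

end TwistedMul

/-! ### Row vectors, Hessenberg matrices and homogeneous combinations -/

section RowAction

variable {K : Type*} [Field K]

/-- The action `v ↦ v A` of matrices on finitely supported row vectors. It reverses products:
`rowAct (A B) = rowAct B * rowAct A`. -/
noncomputable def rowAct : InfMat K ≃ₗ[K] Module.End K (ℕ →₀ K) :=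
  Finsupp.llift (ℕ →₀ K) K K ℕ

@[simp]
theorem rowAct_single (A : InfMat K) (i : ℕ) (c : K) : rowAct A (Finsupp.single i c) = c • A i := by
  simp [rowAct]

theorem rowAct_infMul (A B : InfMat K) : rowAct (infMul A B) = rowAct B * rowAct A := by
  ext1 i
  ext1
  simp [infMul, rowAct, Finsupp.lift_apply]

theorem rowAct_infPow (A : InfMat K) (m : ℕ) : rowAct (infPow A m) = rowAct A ^ m := by
  induction m with
  | zero =>
    ext1 i
    ext1
    simp [infPow]
  | succ m ih => rw [infPow, rowAct_infMul, ih, pow_succ']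

theorem infPow_apply (A : InfMat K) (m i : ℕ) :
    infPow A m i = (rowAct A ^ m) (Finsupp.single i 1) := by
  rw [← rowAct_infPow, rowAct_single, one_smul]

theorem rowAct_shiftY_pow_single (k i : ℕ) (c : K) :
    (rowAct (shiftY K) ^ k) (Finsupp.single i c) = Finsupp.single (i + k) c := by
  induction k with
  | zero => rfl
  | succ k ih => simp [pow_succ', ih, shiftY, add_assoc]

/-- The row vectors whose entries vanish outside the columns `0, …, N`; they are the coordinate
vectors of elements of degree `N`. -/
abbrev rowsLE (K : Type*) [Field K] (N : ℕ) : Submodule K (ℕ →₀ K) :=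
  Finsupp.supported K K (Finset.range (N + 1) : Set ℕ)

theorem mem_rowsLE_iff {N : ℕ} {v : ℕ →₀ K} : v ∈ rowsLE K N ↔ ∀ j, N < j → v j = 0 := by
  simp only [Finsupp.mem_supported', Finset.coe_range, Set.mem_Iio, not_lt, Nat.succ_le_iff]

theorem single_mem_rowsLE (i : ℕ) (c : K) : Finsupp.single i c ∈ rowsLE K i :=
  Finsupp.single_mem_supported K c (by simp)

theorem map_eq_of_mem_rowsLE {V : Type*} [AddCommMonoid V] [Module K V]
    {f g : (ℕ →₀ K) →ₗ[K] V} {N : ℕ}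
    (h : ∀ j ≤ N, f (Finsupp.single j 1) = g (Finsupp.single j 1)) {v : ℕ →₀ K}
    (hv : v ∈ rowsLE K N) : f v = g v := by
  rw [rowsLE, Finsupp.supported_eq_span_single] at hv
  refine LinearMap.eqOn_span ?_ hv
  rintro _ ⟨j, hj, rfl⟩
  exact h j (Nat.lt_succ_iff.1 (Finset.mem_range.1 hj))

/-- Row `k` of the matrix vanishes beyond column `k + 1`. -/
def IsHessenberg (M : InfMat K) : Prop :=
  ∀ k j, k + 1 < j → M k j = 0

namespace IsHessenberg

variable {M : InfMat K}

theorem row_mem (hM : IsHessenberg M) (k : ℕ) : M k ∈ rowsLE K (k + 1) :=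
  mem_rowsLE_iff.2 (hM k)

theorem rowAct_mem (hM : IsHessenberg M) {N : ℕ} {v : ℕ →₀ K} (hv : v ∈ rowsLE K N) :
    rowAct M v ∈ rowsLE K (N + 1) := by
  refine mem_rowsLE_iff.2 fun j hj => ?_
  refine map_eq_of_mem_rowsLE (f := Finsupp.lapply j ∘ₗ rowAct M) (g := 0) (fun k hk => ?_) hv
  simpa using hM k j (by omega)

theorem rowAct_pow_single_mem (hM : IsHessenberg M) (m r : ℕ) :
    (rowAct M ^ m) (Finsupp.single r 1) ∈ rowsLE K (r + m) := by
  induction m with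
  | zero => exact single_mem_rowsLE r 1
  | succ m ih =>
    rw [pow_succ', Module.End.mul_apply]
    exact hM.rowAct_mem ih

end IsHessenberg

section HomogComb

variable {E : Type*} [Semiring E] [Algebra K E]

/-- The combination `∑_j v_j y^j x^{N-j}` of degree `N` with coordinate vector `v`. The exponent
`N - j` is only meaningful for `v ∈ rowsLE K N`. -/
noncomputable def homogComb (y x : E) (N : ℕ) : (ℕ →₀ K) →ₗ[K] E :=
  Finsupp.linearCombination K fun j => y ^ j * x ^ (N - j)

theorem homogComb_single (y x : E) (N j : ℕ) (c : K) :
    homogComb y x N (Finsupp.single j c) = c • (y ^ j * x ^ (N - j)) := by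
  rw [homogComb, Finsupp.linearCombination_single]

theorem homogComb_mul_pow (y x : E) (p : ℕ) {N : ℕ} {v : ℕ →₀ K} (hv : v ∈ rowsLE K N) :
    homogComb y x N v * x ^ p = homogComb y x (N + p) v := by
  refine map_eq_of_mem_rowsLE (f := LinearMap.mulRight K (x ^ p) ∘ₗ homogComb y x N)
    (fun j hj => ?_) hv
  rw [LinearMap.comp_apply, LinearMap.mulRight_apply, homogComb_single, homogComb_single, one_smul,
    one_smul, mul_assoc, ← pow_add, Nat.sub_add_comm hj]

variable {M : InfMat K} {y x : E}

theorem IsHessenberg.mul_homogComb (hM : IsHessenberg M)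
    (hxy : ∀ k, x * y ^ k = homogComb y x (k + 1) (M k)) {N : ℕ} {v : ℕ →₀ K}
    (hv : v ∈ rowsLE K N) :
    x * homogComb y x N v = homogComb y x (N + 1) (rowAct M v) := by
  refine map_eq_of_mem_rowsLE (f := LinearMap.mulLeft K x ∘ₗ homogComb y x N)
    (g := homogComb y x (N + 1) ∘ₗ rowAct M) (fun j hj => ?_) hv
  calc x * homogComb y x N (Finsupp.single j (1 : K))
    _ = homogComb y x (j + 1) (M j) * x ^ (N - j) := by
      rw [homogComb_single, one_smul, ← mul_assoc, hxy]
    _ = homogComb y x (N + 1) (rowAct M (Finsupp.single j 1)) := by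
      rw [homogComb_mul_pow y x _ (hM.row_mem j), rowAct_single, one_smul,
        show j + 1 + (N - j) = N + 1 by omega]

theorem IsHessenberg.pow_mul_pow (hM : IsHessenberg M)
    (hxy : ∀ k, x * y ^ k = homogComb y x (k + 1) (M k)) (m k : ℕ) :
    x ^ m * y ^ k = homogComb y x (k + m) ((rowAct M ^ m) (Finsupp.single k 1)) := by
  induction m with
  | zero => simp [homogComb_single]
  | succ m ih =>
    rw [pow_succ', mul_assoc, ih, hM.mul_homogComb hxy (hM.rowAct_pow_single_mem m k),
      pow_succ', Module.End.mul_apply, add_assoc]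

end HomogComb

variable {M : InfMat K}

theorem IsHessenberg.shift_mul_iff (hM : IsHessenberg M) (k : ℕ) :
    infMul (infPow (shiftY K) k) M =
      ∑ j ∈ Finset.range (k + 2), M k j • infMul (infPow M (k + 1 - j)) (infPow (shiftY K) j) ↔
    rowAct M * rowAct (shiftY K) ^ k =
      homogComb (rowAct (shiftY K)) (rowAct M) (k + 1) (M k) := by
  rw [← rowAct.injective.eq_iff, map_sum, homogComb,
    Finsupp.linearCombination_apply_of_mem_supported K (hM.row_mem k)]
  simp only [map_smul, rowAct_infMul, rowAct_infPow]

theorem rowAct_mul_shiftY_pow_eq_iff {k : ℕ} {f : Module.End K (ℕ →₀ K)} :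
    rowAct M * rowAct (shiftY K) ^ k = f ↔ ∀ i, M (i + k) = f (Finsupp.single i 1) := by
  constructor
  · rintro rfl i
    simp [rowAct_shiftY_pow_single]
  · intro h
    ext1 i
    ext1
    simp [rowAct_shiftY_pow_single, h]

theorem IsHessenberg.isGradedTwistingMatrix_iff (hM : IsHessenberg M) :
    IsGradedTwistingMatrix M ↔ M 0 = Finsupp.single 0 1 ∧ ∀ k i, M (i + k) =
      homogComb (rowAct (shiftY K)) (rowAct M) (k + 1) (M k) (Finsupp.single i 1) := by
  simp only [← rowAct_mul_shiftY_pow_eq_iff, ← hM.shift_mul_iff]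
  exact ⟨fun h => ⟨h.row_zero, h.shift_mul⟩, fun h => ⟨h.1, hM, h.2⟩⟩

end RowAction

/-! ### Twisting maps of polynomial rings and their matrices -/

section PolynomialTwist

open Polynomial

theorem linearMap_ext_X_pow {R V : Type*} [Semiring R] [AddCommMonoid V] [Module R V]
    {f g : R[X] →ₗ[R] V} (h : ∀ i : ℕ, f (X ^ i) = g (X ^ i)) : f = g :=
  (Polynomial.basisMonomials R).ext fun i => by
    simpa only [Polynomial.coe_basisMonomials, X_pow_eq_monomial] using h i

theorem linearMap_ext_X_pow_tmul {R V : Type*} [CommSemiring R] [AddCommMonoid V] [Module R V]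
    {f g : (R[X] ⊗[R] R[X]) ⊗[R] R[X] →ₗ[R] V}
    (h : ∀ i j k : ℕ,
      f (((X ^ i) ⊗ₜ[R] (X ^ j)) ⊗ₜ[R] (X ^ k)) = g (((X ^ i) ⊗ₜ[R] (X ^ j)) ⊗ₜ[R] (X ^ k))) :
    f = g := by
  refine TensorProduct.ext <| TensorProduct.ext <| linearMap_ext_X_pow fun i =>
    linearMap_ext_X_pow fun j => linearMap_ext_X_pow fun k => ?_
  exact h i j k

variable {K : Type*} [Field K]

/-- The homogeneous tensor `∑_j v_j x^{N-j} ⊗ y^j` of degree `N` with coordinate vector `v`. The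
exponent `N - j` is only meaningful for `v ∈ rowsLE K N`. -/
noncomputable def homogTensor (K : Type*) [Field K] (N : ℕ) : (ℕ →₀ K) →ₗ[K] K[X] ⊗[K] K[X] :=
  Finsupp.linearCombination K fun j => (X ^ (N - j) : K[X]) ⊗ₜ[K] (X ^ j : K[X])

theorem homogTensor_single (N j : ℕ) : homogTensor K N (Finsupp.single j 1) =
    (X ^ (N - j) : K[X]) ⊗ₜ[K] (X ^ j : K[X]) := by
  rw [homogTensor, Finsupp.linearCombination_single, one_smul]

theorem homogTensor_injective (N : ℕ) : Function.Injective (homogTensor K N) := by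
  have bidegree_injective : Function.Injective fun j : ℕ => (N - j, j) :=
    fun _ _ h => (Prod.ext_iff.1 h).2
  have independent := (((Polynomial.basisMonomials K).tensorProduct
    (Polynomial.basisMonomials K)).linearIndependent.comp _ bidegree_injective)
  simpa only [LinearIndependent, homogTensor, Function.comp_def, Module.Basis.tensorProduct_apply,
    Polynomial.coe_basisMonomials, X_pow_eq_monomial] using independent

theorem homogTensor_eq_sum {N : ℕ} {v : ℕ →₀ K} (hv : v ∈ rowsLE K N) :
    homogTensor K N v = ∑ j ∈ Finset.range (N + 1),
      v j • ((X ^ (N - j) : K[X]) ⊗ₜ[K] (X ^ j : K[X])) :=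
  Finsupp.linearCombination_apply_of_mem_supported K hv

theorem rTensor_mulLeft_homogTensor (p : ℕ) {N : ℕ} {v : ℕ →₀ K} (hv : v ∈ rowsLE K N) :
    LinearMap.rTensor K[X] (LinearMap.mulLeft K (X ^ p)) (homogTensor K N v) =
      homogTensor K (N + p) v := by
  refine map_eq_of_mem_rowsLE (f := LinearMap.rTensor K[X] (LinearMap.mulLeft K (X ^ p)) ∘ₗ
    homogTensor K N) (fun j hj => ?_) hv
  rw [LinearMap.comp_apply, homogTensor_single, homogTensor_single, LinearMap.rTensor_tmul,
    LinearMap.mulLeft_apply, ← pow_add, add_comm p, Nat.sub_add_comm hj]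

theorem lTensor_mulRight_homogTensor (q N : ℕ) (v : ℕ →₀ K) :
    LinearMap.lTensor K[X] (LinearMap.mulRight K (X ^ q)) (homogTensor K N v) =
      homogTensor K (N + q) ((rowAct (shiftY K) ^ q) v) := by
  suffices LinearMap.lTensor K[X] (LinearMap.mulRight K (X ^ q)) ∘ₗ homogTensor K N =
      homogTensor K (N + q) ∘ₗ (rowAct (shiftY K) ^ q) from LinearMap.congr_fun this v
  refine Finsupp.lhom_ext' fun j => LinearMap.ext_ring ?_
  simp only [LinearMap.comp_apply, Finsupp.lsingle_apply, rowAct_shiftY_pow_single,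
    homogTensor_single, LinearMap.lTensor_tmul, LinearMap.mulRight_apply, ← pow_add,
    Nat.add_sub_add_right]

variable {τ : K[X] ⊗[K] K[X] →ₗ[K] K[X] ⊗[K] K[X]} {M : InfMat K}

theorem IsHessenberg.hasMatrix_iff (hM : IsHessenberg M) :
    HasMatrix τ M ↔ ∀ k : ℕ, τ ((X ^ k) ⊗ₜ[K] X) = homogTensor K (k + 1) (M k) :=
  forall_congr' fun k => by rw [homogTensor_eq_sum (hM.row_mem k)]

theorem IsHessenberg.twistedMul_homogTensor (hM : IsHessenberg M) (m : ℕ)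
    (hτ : ∀ r : ℕ, τ ((X ^ r) ⊗ₜ[K] (X ^ m)) =
      homogTensor K (r + m) ((rowAct M ^ m) (Finsupp.single r 1)))
    {N : ℕ} {v : ℕ →₀ K} (hv : v ∈ rowsLE K N) :
    twistedMul τ (homogTensor K N v) ((X ^ m : K[X]) ⊗ₜ[K] (1 : K[X])) =
      homogTensor K (N + m) ((rowAct M ^ m) v) := by
  refine map_eq_of_mem_rowsLE
    (f := (twistedMul τ).flip ((X ^ m : K[X]) ⊗ₜ[K] (1 : K[X])) ∘ₗ homogTensor K N)
    (g := homogTensor K (N + m) ∘ₗ (rowAct M ^ m)) (fun j hj => ?_) hv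
  rw [LinearMap.comp_apply, LinearMap.flip_apply, homogTensor_single, twistedMul_tmul_one, hτ,
    rTensor_mulLeft_homogTensor _ (hM.rowAct_pow_single_mem m j), LinearMap.comp_apply,
    show j + m + (N - j) = N + m by omega]

/-- `τ(y^r ⊗ x^i) = ∑_j (M^i)_{rj} x^{r+i-j} ⊗ y^j` for all `r` and `i`. This determines `τ`,
and for Hessenberg `M` the case `i = 1` is `HasMatrix`. -/
def IsTwistOf (τ : K[X] ⊗[K] K[X] →ₗ[K] K[X] ⊗[K] K[X]) (M : InfMat K) : Prop :=
  ∀ r i : ℕ, τ ((X ^ r) ⊗ₜ[K] (X ^ i)) = homogTensor K (r + i) ((rowAct M ^ i) (Finsupp.single r 1))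

theorem isTwistOf_twistOfMatrix (M : InfMat K) : IsTwistOf (twistOfMatrix M) M := by
  intro r i
  have X_pow_eq_basis : ∀ s : ℕ, (X ^ s : K[X]) = Polynomial.basisMonomials K s := by
    simp [X_pow_eq_monomial]
  rw [twistOfMatrix, TensorProduct.lift.tmul, X_pow_eq_basis r, X_pow_eq_basis i,
    Module.Basis.constr_basis, Module.Basis.constr_basis, infPow_apply]
  rfl

namespace IsTwistOf

theorem hasMatrix (hτ : IsTwistOf τ M) (hM : IsHessenberg M) : HasMatrix τ M :=
  hM.hasMatrix_iff.2 fun k => by simpa using hτ k 1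

theorem twistedMul_one_tmul_homogTensor (hτ : IsTwistOf τ M) (i : ℕ) {N : ℕ} {v : ℕ →₀ K}
    (hv : v ∈ rowsLE K N) :
    twistedMul τ ((1 : K[X]) ⊗ₜ[K] (X ^ i : K[X])) (homogTensor K N v) =
      homogTensor K (N + i)
        (homogComb (rowAct (shiftY K)) (rowAct M) N v (Finsupp.single i 1)) := by
  refine map_eq_of_mem_rowsLE
    (f := twistedMul τ ((1 : K[X]) ⊗ₜ[K] (X ^ i : K[X])) ∘ₗ homogTensor K N)
    (g := homogTensor K (N + i) ∘ₗ LinearMap.applyₗ (Finsupp.single i (1 : K)) ∘ₗ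
      homogComb (rowAct (shiftY K)) (rowAct M) N) (fun j hj => ?_) hv
  rw [LinearMap.comp_apply, homogTensor_single, twistedMul_one_tmul, hτ,
    lTensor_mulRight_homogTensor, LinearMap.comp_apply, LinearMap.comp_apply, homogComb_single,
    one_smul, LinearMap.applyₗ_apply_apply, Module.End.mul_apply,
    show i + (N - j) + j = N + i by omega]

theorem apply_one_tmul (hτ : IsTwistOf τ M) (h0 : M 0 = Finsupp.single 0 1) (f : K[X]) :
    τ ((1 : K[X]) ⊗ₜ[K] f) = f ⊗ₜ[K] (1 : K[X]) := by
  have row_pow : ∀ i : ℕ, (rowAct M ^ i) (Finsupp.single 0 1) = Finsupp.single 0 1 := by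
    intro i
    induction i with
    | zero => rfl
    | succ i ih => rw [pow_succ', Module.End.mul_apply, ih, rowAct_single, one_smul, h0]
  suffices τ ∘ₗ TensorProduct.mk K K[X] K[X] 1 = (TensorProduct.mk K K[X] K[X]).flip 1 from
    LinearMap.congr_fun this f
  refine linearMap_ext_X_pow fun i => ?_
  simpa [row_pow, homogTensor_single] using hτ 0 i

theorem apply_tmul_one (hτ : IsTwistOf τ M) (g : K[X]) :
    τ (g ⊗ₜ[K] (1 : K[X])) = (1 : K[X]) ⊗ₜ[K] g := by
  suffices τ ∘ₗ (TensorProduct.mk K K[X] K[X]).flip 1 = TensorProduct.mk K K[X] K[X] 1 from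
    LinearMap.congr_fun this g
  refine linearMap_ext_X_pow fun r => ?_
  simpa [homogTensor_single] using hτ r 0

theorem isTwistingMap (hτ : IsTwistOf τ M) (hM : IsGradedTwistingMatrix M) : IsTwistingMap τ where
  one_tmul := hτ.apply_one_tmul hM.row_zero
  tmul_one := hτ.apply_tmul_one
  tmul_mul := by
    have hess : IsHessenberg M := hM.hessenberg
    refine linearMap_ext_X_pow_tmul fun r i m => ?_
    simp only [LinearMap.comp_apply, LinearEquiv.coe_coe, TensorProduct.assoc_tmul,
      LinearMap.lTensor_tmul, LinearMap.mul'_apply, LinearMap.rTensor_tmul,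
      rTensor_mul'_lTensor_tmul]
    rw [← pow_add, hτ, hτ, hess.twistedMul_homogTensor m (fun r => hτ r m)
      (hess.rowAct_pow_single_mem i r), ← Module.End.mul_apply, ← pow_add, add_comm m i, add_assoc]
  mul_tmul := by
    have hess : IsHessenberg M := hM.hessenberg
    have rowAct_pow_mul_shiftY_pow :=
      hess.pow_mul_pow fun k => (hess.shift_mul_iff k).1 (hM.shift_mul k)
    refine linearMap_ext_X_pow_tmul fun i k m => ?_
    simp only [LinearMap.comp_apply, LinearEquiv.coe_coe, TensorProduct.assoc_tmul,
      LinearMap.lTensor_tmul, LinearMap.mul'_apply, LinearMap.rTensor_tmul,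
      lTensor_mul'_rTensor_tmul]
    rw [← pow_add, hτ, hτ, hτ.twistedMul_one_tmul_homogTensor i (hess.rowAct_pow_single_mem m k),
      ← rowAct_pow_mul_shiftY_pow, Module.End.mul_apply, rowAct_shiftY_pow_single,
      show k + m + i = i + k + m by omega]

theorem isGradedTwistingMap (hτ : IsTwistOf τ M) (hM : IsGradedTwistingMatrix M) :
    IsGradedTwistingMap τ where
  isTwistingMap := hτ.isTwistingMap hM
  graded r i := by
    have hess : IsHessenberg M := hM.hessenberg
    exact ⟨(rowAct M ^ i) (Finsupp.single r 1), by
      rw [hτ, homogTensor_eq_sum (hess.rowAct_pow_single_mem i r), add_comm r i]⟩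

end IsTwistOf

namespace IsTwistingMap

theorem isTwistOf (h : IsTwistingMap τ) (hM : IsHessenberg M) (hτ : HasMatrix τ M) :
    IsTwistOf τ M := by
  rw [hM.hasMatrix_iff] at hτ
  intro r i
  induction i with
  | zero => simp [h.tmul_one, homogTensor_single]
  | succ i ih =>
    have mul_X := hM.twistedMul_homogTensor 1 (fun r => by simpa using hτ r)
      (hM.rowAct_pow_single_mem i r)
    rw [pow_one, pow_one] at mul_X
    rw [pow_succ, h.apply_tmul_mul, ih, mul_X, pow_succ', Module.End.mul_apply, add_assoc]

theorem isGradedTwistingMatrix (h : IsTwistingMap τ) (hM : IsHessenberg M) (hτ : HasMatrix τ M) :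
    IsGradedTwistingMatrix M := by
  have hT := h.isTwistOf hM hτ
  rw [hM.hasMatrix_iff] at hτ
  refine hM.isGradedTwistingMatrix_iff.2 ⟨?_, fun k i => ?_⟩
  · apply homogTensor_injective 1
    have := hτ 0
    rw [pow_zero, h.one_tmul] at this
    rw [← this, homogTensor_single, Nat.sub_zero, pow_one, pow_zero]
  · apply homogTensor_injective (i + k + 1)
    rw [← hτ, pow_add, h.apply_mul_tmul, hτ, hT.twistedMul_one_tmul_homogTensor i (hM.row_mem k),
      show k + 1 + i = i + k + 1 by omega]

end IsTwistingMap

theorem IsHessenberg.gradedTwisting_tfae (hM : IsHessenberg M) :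
    [IsGradedTwistingMap (twistOfMatrix M),
      IsGradedTwistingMatrix M,
      ∃ τ : K[X] ⊗[K] K[X] →ₗ[K] K[X] ⊗[K] K[X], IsGradedTwistingMap τ ∧ HasMatrix τ M].TFAE := by
  have hT := isTwistOf_twistOfMatrix M
  tfae_have 1 → 3 := fun h => ⟨_, h, hT.hasMatrix hM⟩
  tfae_have 3 → 2 := fun ⟨_, h, hτ⟩ => h.isTwistingMap.isGradedTwistingMatrix hM hτ
  tfae_have 2 → 1 := hT.isGradedTwistingMap
  tfae_finish

end PolynomialTwist

/-! ### Weight matrices -/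

section WeightMatrix

variable {K : Type*} [Field K]

/-- The matrix with rows `w_{j+1} E_0 - w_j E_1 + (w_j / w_{j+1}) E_{j+1}`. It sends `w_j⁻¹ E_j` to
`w_{j+1}⁻¹ E_{j+1} - E_1 + (w_{j+1} / w_j) E_0`, which makes its powers computable. -/
noncomputable def weightMat (w : ℕ → K) : InfMat K := fun j =>
  Finsupp.single 0 (w (j + 1)) - Finsupp.single 1 (w j) +
    Finsupp.single (j + 1) (w j / w (j + 1))

/-- The defect from additivity, shifted by `1`, of the partial sums of the ratios
`w_{t+1} / w_t`. -/
noncomputable def weightCocycle (w : ℕ → K) (i k : ℕ) : K :=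
  1 + ∑ t ∈ Finset.range (i + k), w (t + 1) / w t - ∑ t ∈ Finset.range i, w (t + 1) / w t -
    ∑ t ∈ Finset.range k, w (t + 1) / w t

variable {w : ℕ → K}

theorem weightCocycle_zero_right (i : ℕ) : weightCocycle w i 0 = 1 := by
  simp [weightCocycle]

theorem weightCocycle_succ_right (i k : ℕ) : weightCocycle w i (k + 1) =
    weightCocycle w i k + w (i + k + 1) / w (i + k) - w (k + 1) / w k := by
  rw [weightCocycle, weightCocycle, ← add_assoc, Finset.sum_range_succ, Finset.sum_range_succ]
  ring

theorem isHessenberg_weightMat : IsHessenberg (weightMat w) := by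
  intro k j hkj
  simp [weightMat, show 0 ≠ j by omega, show 1 ≠ j by omega, show k + 1 ≠ j by omega]

theorem weightMat_zero (h0 : w 0 = 1) (h1 : w 1 = 1) :
    weightMat w 0 = Finsupp.single 0 1 := by
  simp [weightMat, h0, h1]

theorem rowAct_weightMat_single_div {j : ℕ} (hj : w j ≠ 0) (x : K) :
    rowAct (weightMat w) (Finsupp.single j (x / w j)) =
      Finsupp.single 0 (x * (w (j + 1) / w j)) - Finsupp.single 1 x +
        Finsupp.single (j + 1) (x / w (j + 1)) := by
  rw [rowAct_single, weightMat, smul_add, smul_sub, Finsupp.smul_single, Finsupp.smul_single,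
    Finsupp.smul_single, smul_eq_mul, smul_eq_mul, smul_eq_mul, div_mul_cancel₀ x hj,
    div_mul_div_cancel₀ hj, div_mul_eq_mul_div, mul_div_assoc]

theorem rowAct_weightMat_pow_single (hw : ∀ j, w j ≠ 0) (h0 : w 0 = 1) (h1 : w 1 = 1) (i k : ℕ) :
    (rowAct (weightMat w) ^ k) (Finsupp.single i 1) =
      Finsupp.single (i + k) (w i / w (i + k)) - Finsupp.single k (w i / w k) +
        Finsupp.single 0 (w i * weightCocycle w i k) := by
  induction k with
  | zero => simp [hw i, h0, weightCocycle_zero_right]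
  | succ k ih =>
    rw [pow_succ', Module.End.mul_apply, ih, map_add, map_sub, rowAct_weightMat_single_div (hw _),
      rowAct_weightMat_single_div (hw _), rowAct_single, weightMat_zero h0 h1,
      weightCocycle_succ_right, Finsupp.smul_single, smul_eq_mul, mul_one, mul_sub, mul_add,
      Finsupp.single_sub, Finsupp.single_add, ← add_assoc i k 1]
    abel

theorem homogComb_weightMat (hw : ∀ j, w j ≠ 0) (h0 : w 0 = 1) (h1 : w 1 = 1) (i k : ℕ) :
    homogComb (rowAct (shiftY K)) (rowAct (weightMat w)) (k + 1) (weightMat w k)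
        (Finsupp.single i 1) =
      Finsupp.single 0 (w i * w (k + 1) * weightCocycle w i (k + 1)) -
        Finsupp.single 1 (w i * w k * weightCocycle w i k) +
        Finsupp.single (i + k + 1)
          (w i * w (k + 1) / w (i + k + 1) - w i * w k / w (i + k) + w k / w (k + 1)) := by
  have mul_div_self (x : K) (j : ℕ) : w j * (x / w j) = x := mul_div_cancel₀ x (hw j)
  conv_lhs => rw [weightMat]
  simp only [map_add, map_sub, homogComb_single, LinearMap.add_apply, LinearMap.sub_apply,
    LinearMap.smul_apply, Module.End.mul_apply, Nat.sub_zero, Nat.add_sub_cancel, Nat.sub_self,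
    pow_zero, Module.End.one_apply, rowAct_weightMat_pow_single hw h0 h1,
    rowAct_shiftY_pow_single, smul_add, smul_sub, Finsupp.smul_single, smul_eq_mul, mul_one,
    mul_div_self, zero_add, Finsupp.single_add, Finsupp.single_sub, ← add_assoc]
  rw [mul_left_comm, mul_left_comm (w k), ← mul_assoc (w i), ← mul_assoc (w i),
    mul_div_left_comm, mul_div_left_comm (w k), ← mul_div_assoc, ← mul_div_assoc]
  abel

theorem inv_eq_of_sub_eq_of_mul_eq {s s' ρ σ : K} (hsub : s' = s + ρ - σ)
    (hmul : ρ * s = σ * s') : ρ⁻¹ = s'⁻¹ - s⁻¹ + σ⁻¹ := by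
  have hfactor : (ρ - σ) * (s - σ) = 0 := by linear_combination hmul + σ * hsub
  rcases mul_eq_zero.1 hfactor with h | h
  · obtain rfl := sub_eq_zero.1 h
    simp [hsub]
  · obtain rfl := sub_eq_zero.1 h
    simp [hsub]

theorem weight_div_weight_succ (hw : ∀ j, w j ≠ 0) {i : ℕ}
    (h : ∀ k, w (i + k) = w i * w k * weightCocycle w i k) (k : ℕ) :
    w (i + k) / w (i + k + 1) =
      w i * w (k + 1) / w (i + k + 1) - w i * w k / w (i + k) + w k / w (k + 1) := by
  have cocycle_eq (k : ℕ) : weightCocycle w i k = w (i + k) / (w i * w k) := by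
    rw [h k, mul_div_cancel_left₀ _ (mul_ne_zero (hw i) (hw k))]
  have hmul : w (i + k + 1) / w (i + k) * weightCocycle w i k =
      w (k + 1) / w k * weightCocycle w i (k + 1) := by
    rw [cocycle_eq, cocycle_eq, ← add_assoc]
    field_simp [hw]
  simpa only [cocycle_eq, inv_div, ← add_assoc] using
    inv_eq_of_sub_eq_of_mul_eq (weightCocycle_succ_right i k) hmul

theorem weightMat_isGradedTwistingMatrix_iff (hw : ∀ j, w j ≠ 0) (h0 : w 0 = 1) (h1 : w 1 = 1) :
    IsGradedTwistingMatrix (weightMat w) ↔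
      ∀ i k, w (i + k) = w i * w k * weightCocycle w i k := by
  simp only [isHessenberg_weightMat.isGradedTwistingMatrix_iff, weightMat_zero h0 h1, true_and,
    homogComb_weightMat hw h0 h1]
  constructor
  · intro h i k
    cases k with
    | zero => simp [h0, weightCocycle_zero_right]
    | succ k =>
      simpa [weightMat, ← add_assoc] using DFunLike.congr_fun (h k i) 0
  · intro h k i
    rw [weightMat, weight_div_weight_succ hw (h i), ← h i k, ← h i (k + 1), add_assoc]

end WeightMatrix

/-! ### Weights `d^c` -/

section PowerWeights

/-- `c` is additive up to an excess of at most one: `0 ≤ c (i + k) - c i - c k ≤ 1`. This is the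
property dual to `IsQuasiBalanced` when `c` counts the terms of a sequence below a bound. -/
def IsNearlyAdditive (c : ℕ → ℕ) : Prop :=
  ∀ i k, c i + c k ≤ c (i + k) ∧ c (i + k) ≤ c i + c k + 1

variable {K : Type*} [Field K] {d : K} {c : ℕ → ℕ}

theorem sum_range_pow_div_pow (hd : d ≠ 0) (h0 : c 0 = 0)
    (hc : ∀ j, c (j + 1) = c j ∨ c (j + 1) = c j + 1) (m : ℕ) :
    ∑ t ∈ Finset.range m, d ^ c (t + 1) / d ^ c t = m - (1 - d) * c m := by
  induction m with
  | zero => simp [h0]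
  | succ m ih =>
    rw [Finset.sum_range_succ, ih]
    rcases hc m with h | h
    · rw [h, div_self (pow_ne_zero _ hd)]
      push_cast
      ring
    · rw [h, pow_succ, mul_div_cancel_left₀ d (pow_ne_zero _ hd)]
      push_cast
      ring

theorem weightCocycle_pow (hd : d ≠ 0) (h0 : c 0 = 0)
    (hc : ∀ j, c (j + 1) = c j ∨ c (j + 1) = c j + 1) (i k : ℕ) :
    weightCocycle (fun j => d ^ c j) i k = 1 + (1 - d) * (c i + c k - c (i + k)) := by
  simp only [weightCocycle, sum_range_pow_div_pow hd h0 hc]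
  push_cast
  ring

theorem IsNearlyAdditive.pow_eq (h : IsNearlyAdditive c) (d : K) (i k : ℕ) :
    d ^ c (i + k) = d ^ c i * d ^ c k * (1 + (1 - d) * (c i + c k - c (i + k))) := by
  obtain h | h : c (i + k) = c i + c k ∨ c (i + k) = c i + c k + 1 := by
    have := h i k
    omega
  all_goals
    rw [h]
    push_cast
    ring

theorem isNearlyAdditive_of_pow_eq (hd : d ≠ 0) (hd1 : d ≠ 1) (h0 : c 0 = 0)
    (hc : ∀ j, c (j + 1) = c j ∨ c (j + 1) = c j + 1)
    (h : ∀ i k, d ^ c (i + k) = d ^ c i * d ^ c k * (1 + (1 - d) * (c i + c k - c (i + k)))) :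
    IsNearlyAdditive c := by
  have hsq : (d - 1) ^ 2 ≠ 0 := pow_ne_zero 2 (sub_ne_zero.2 hd1)
  have excess_ne_neg_one (i k : ℕ) : c i + c k ≠ c (i + k) + 1 := by
    intro hcik
    have hpow := h i k
    rw [← pow_add, ← Nat.cast_add, hcik, pow_succ, mul_assoc, eq_comm,
      mul_eq_left₀ (pow_ne_zero _ hd)] at hpow
    push_cast at hpow
    exact hsq (by linear_combination -hpow)
  have excess_ne_two (i k : ℕ) : c (i + k) ≠ c i + c k + 2 := by
    intro hcik
    have hpow := h i k
    rw [← pow_add, hcik, pow_add, mul_right_inj' (pow_ne_zero _ hd)] at hpow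
    push_cast at hpow
    exact hsq (by linear_combination hpow)
  intro i k
  induction k with
  | zero => simp [h0]
  | succ k ih =>
    have := excess_ne_neg_one i (k + 1)
    have := excess_ne_two i (k + 1)
    have := hc k
    have := hc (i + k)
    rw [add_assoc] at this
    omega

theorem weightMat_pow_isGradedTwistingMatrix_iff (hd : d ≠ 0) (hd1 : d ≠ 1) (h0 : c 0 = 0)
    (h1 : c 1 = 0) (hc : ∀ j, c (j + 1) = c j ∨ c (j + 1) = c j + 1) :
    IsGradedTwistingMatrix (weightMat fun j => d ^ c j) ↔ IsNearlyAdditive c := by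
  rw [weightMat_isGradedTwistingMatrix_iff (fun j => pow_ne_zero _ hd) (by rw [h0, pow_zero])
    (by rw [h1, pow_zero])]
  simp only [weightCocycle_pow hd h0 hc]
  exact ⟨isNearlyAdditive_of_pow_eq hd hd1 h0 hc, fun h => h.pow_eq d⟩

end PowerWeights

/-! ### Sequences and their counting functions -/

section Sequences

/-- The number of `r ≥ 1` with `L r < j`, for a sequence with `0 < L 1 < L 2 < ⋯`. -/
def countBelow (L : ℕ → ℕ) : ℕ → ℕ
  | 0 => 0
  | j + 1 => levelOf L j

theorem isQuasiBalanced_iff_add {L : ℕ → ℕ} : IsQuasiBalanced L ↔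
    ∀ r s, 1 ≤ r → 1 ≤ s → L (r + s) ≤ L r + L s + 1 ∧ L r + L s ≤ L (r + s) := by
  constructor
  · intro h r s hr hs
    simpa using h (r + s) r hr (by omega)
  · intro h r j hj hjr
    simpa [Nat.add_sub_cancel' hjr.le] using h j (r - j) hj (by omega)

section Duality

variable {L c : ℕ → ℕ}

theorem superadditive_iff_of_le_iff_lt (hcL : ∀ r j, 1 ≤ r → (r ≤ c j ↔ L r < j)) :
    (∀ i k, c i + c k ≤ c (i + k)) ↔
      ∀ r s, 1 ≤ r → 1 ≤ s → L (r + s) ≤ L r + L s + 1 := by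
  constructor
  · intro h r s hr hs
    have := (hcL r (L r + 1) hr).2 (Nat.lt_succ_self _)
    have := (hcL s (L s + 1) hs).2 (Nat.lt_succ_self _)
    have := h (L r + 1) (L s + 1)
    have := (hcL (r + s) (L r + 1 + (L s + 1)) (by omega)).1 (by omega)
    omega
  · intro h i k
    have lt_of_pos (j : ℕ) (hj : 1 ≤ c j) : L (c j) < j := (hcL _ j hj).1 le_rfl
    rcases Nat.eq_zero_or_pos (c i + c k) with h0 | hpos
    · omega
    refine (hcL _ _ hpos).2 ?_
    rcases Nat.eq_zero_or_pos (c i) with hi | hi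
    · have := lt_of_pos k (by omega)
      rw [hi, zero_add]
      omega
    rcases Nat.eq_zero_or_pos (c k) with hk | hk
    · have := lt_of_pos i hi
      rw [hk, add_zero]
      omega
    have := lt_of_pos i hi
    have := lt_of_pos k hk
    have := h (c i) (c k) hi hk
    omega

theorem subadditive_add_one_iff_of_le_iff_lt (hcL : ∀ r j, 1 ≤ r → (r ≤ c j ↔ L r < j)) :
    (∀ i k, c (i + k) ≤ c i + c k + 1) ↔
      ∀ r s, 1 ≤ r → 1 ≤ s → L r + L s ≤ L (r + s) := by
  constructor
  · intro h r s hr hs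
    by_contra! hlt
    have := (hcL (r + s) (L r + L s) (by omega)).2 hlt
    have := mt (hcL r (L r) hr).1 (lt_irrefl _)
    have := mt (hcL s (L s) hs).1 (lt_irrefl _)
    have := h (L r) (L s)
    omega
  · intro h i k
    by_contra! hlt
    have := (hcL (c i + 1 + (c k + 1)) (i + k) (by omega)).1 (by omega)
    have := mt (hcL (c i + 1) i (by omega)).2 (Nat.not_succ_le_self _)
    have := mt (hcL (c k + 1) k (by omega)).2 (Nat.not_succ_le_self _)
    have := h (c i + 1) (c k + 1) (by omega) (by omega)
    omega

theorem isQuasiBalanced_iff_isNearlyAdditive (hcL : ∀ r j, 1 ≤ r → (r ≤ c j ↔ L r < j)) :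
    IsQuasiBalanced L ↔ IsNearlyAdditive c := by
  simp only [isQuasiBalanced_iff_add, IsNearlyAdditive, forall_and,
    superadditive_iff_of_le_iff_lt hcL, subadditive_add_one_iff_of_le_iff_lt hcL]

end Duality

variable {L : ℕ → ℕ}

theorem le_apply_of_strictMonoOn (hL : StrictMonoOn L (Set.Ici 1)) (hpos : 0 < L 1) {r : ℕ}
    (hr : 1 ≤ r) : r ≤ L r := by
  induction r, hr using Nat.le_induction with
  | base => exact hpos
  | succ r hr ih => exact ih.trans_lt (hL hr (hr.trans r.le_succ) r.lt_succ_self)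

theorem le_levelOf_iff (hL : StrictMonoOn L (Set.Ici 1)) (hpos : 0 < L 1) {r : ℕ} (hr : 1 ≤ r)
    (j : ℕ) : r ≤ levelOf L j ↔ L r ≤ j := by
  have mem_filter_iff (s : ℕ) :
      s ∈ (Finset.Icc 1 j).filter (fun s => L s ≤ j) ↔ 1 ≤ s ∧ L s ≤ j := by
    rw [Finset.mem_filter, Finset.mem_Icc]
    exact ⟨fun h => ⟨h.1.1, h.2⟩,
      fun h => ⟨⟨h.1, (le_apply_of_strictMonoOn hL hpos h.1).trans h.2⟩, h.2⟩⟩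
  constructor
  · contrapose!
    intro hj
    have hsub : (Finset.Icc 1 j).filter (fun s => L s ≤ j) ⊆ Finset.Icc 1 (r - 1) := by
      intro s hs
      obtain ⟨hs, hsj⟩ := (mem_filter_iff s).1 hs
      have : s < r := (hL.lt_iff_lt hs hr).1 (hsj.trans_lt hj)
      exact Finset.mem_Icc.2 ⟨hs, by omega⟩
    have := Finset.card_le_card hsub
    rw [Nat.card_Icc] at this
    rw [levelOf]
    omega
  · intro hj
    have hsub : Finset.Icc 1 r ⊆ (Finset.Icc 1 j).filter (fun s => L s ≤ j) := by
      intro s hs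
      obtain ⟨hs, hsr⟩ := Finset.mem_Icc.1 hs
      exact (mem_filter_iff s).2 ⟨hs, ((hL.le_iff_le hs hr).2 hsr).trans hj⟩
    simpa [levelOf] using Finset.card_le_card hsub

theorem le_countBelow_iff (hL : StrictMonoOn L (Set.Ici 1)) (hpos : 0 < L 1) (r j : ℕ)
    (hr : 1 ≤ r) : r ≤ countBelow L j ↔ L r < j := by
  cases j with
  | zero => simp [countBelow, Nat.one_le_iff_ne_zero.1 hr]
  | succ j => rw [countBelow, le_levelOf_iff hL hpos hr, Nat.lt_succ_iff]

theorem levelOf_eq_countBelow_add_one (hL : StrictMonoOn L (Set.Ici 1)) (hpos : 0 < L 1) {j : ℕ}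
    (h : 1 ≤ levelOf L j ∧ L (levelOf L j) = j) : levelOf L j = countBelow L j + 1 := by
  have le_countBelow_iff_lt (r : ℕ) (hr : 1 ≤ r) : r ≤ countBelow L j ↔ r < levelOf L j := by
    rw [le_countBelow_iff hL hpos r j hr, ← hL.lt_iff_lt hr h.1, h.2]
  have := le_countBelow_iff_lt (levelOf L j)
  have := le_countBelow_iff_lt (levelOf L j - 1)
  omega

theorem countBelow_le_levelOf (hL : StrictMonoOn L (Set.Ici 1)) (hpos : 0 < L 1) (j : ℕ) :
    countBelow L j ≤ levelOf L j := by
  rcases Nat.eq_zero_or_pos (countBelow L j) with h | h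
  · exact h ▸ Nat.zero_le _
  · exact (le_levelOf_iff hL hpos h j).2 ((le_countBelow_iff hL hpos _ j h).1 le_rfl).le

theorem levelOf_eq_countBelow (hL : StrictMonoOn L (Set.Ici 1)) (hpos : 0 < L 1) {j : ℕ}
    (h : ¬ (1 ≤ levelOf L j ∧ L (levelOf L j) = j)) : levelOf L j = countBelow L j := by
  refine le_antisymm ?_ (countBelow_le_levelOf hL hpos j)
  rcases Nat.eq_zero_or_pos (levelOf L j) with h0 | hlevel
  · exact h0 ▸ Nat.zero_le _
  · have hle := (le_levelOf_iff hL hpos hlevel j).1 le_rfl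
    exact (le_countBelow_iff hL hpos _ j hlevel).2 (hle.lt_of_ne fun heq => h ⟨hlevel, heq⟩)

theorem countBelow_succ_eq_or (hL : StrictMonoOn L (Set.Ici 1)) (hpos : 0 < L 1) (j : ℕ) :
    countBelow L (j + 1) = countBelow L j ∨ countBelow L (j + 1) = countBelow L j + 1 := by
  by_cases h : 1 ≤ levelOf L j ∧ L (levelOf L j) = j
  · exact Or.inr (levelOf_eq_countBelow_add_one hL hpos h)
  · exact Or.inl (levelOf_eq_countBelow hL hpos h)

variable {K : Type*} [Field K] {a : K}

theorem matOfSeq_add_shiftY (hL : StrictMonoOn L (Set.Ici 1)) (hpos : 0 < L 1) (ha : a + 1 ≠ 0) :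
    matOfSeq a L + shiftY K = weightMat fun j => (1 / (a + 1)) ^ countBelow L j := by
  have hd : 1 / (a + 1) ≠ 0 := one_div_ne_zero ha
  funext j
  rw [Pi.add_apply, matOfSeq, shiftY, weightMat, show countBelow L (j + 1) = levelOf L j from rfl]
  split_ifs with h
  · have weight_ratio (m : ℕ) : (1 / (a + 1)) ^ m / (1 / (a + 1)) ^ (m + 1) = a + 1 := by
      rw [pow_succ, div_mul_cancel_left₀ (pow_ne_zero m hd), one_div, inv_inv]
    rw [levelOf_eq_countBelow_add_one hL hpos h, weight_ratio, Nat.add_sub_cancel, add_assoc,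
      ← Finsupp.single_add]
  · rw [levelOf_eq_countBelow hL hpos h, div_self (pow_ne_zero _ hd), smul_sub,
      Finsupp.smul_single, Finsupp.smul_single, smul_eq_mul, mul_one]

theorem isGradedTwistingMatrix_matOfSeq_iff (hL : StrictMonoOn L (Set.Ici 1)) (hpos : 0 < L 1)
    (ha0 : a ≠ 0) (ha : a + 1 ≠ 0) :
    IsGradedTwistingMatrix (matOfSeq a L + shiftY K) ↔ IsQuasiBalanced L := by
  have hd1 : 1 / (a + 1) ≠ 1 := by
    rwa [Ne, div_eq_one_iff_eq ha, right_eq_add]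
  rw [matOfSeq_add_shiftY hL hpos ha,
    weightMat_pow_isGradedTwistingMatrix_iff (one_div_ne_zero ha) hd1 rfl rfl
      (countBelow_succ_eq_or hL hpos),
    isQuasiBalanced_iff_isNearlyAdditive (le_countBelow_iff hL hpos)]

end Sequences

theorem mainTheorem1_general {K : Type*} [Field K] (a : K) (ha0 : a ≠ 0) (ha1 : a ≠ -1)
    (L : ℕ → ℕ) (hL : StrictMonoOn L (Set.Ici 1)) (hpos : 0 < L 1) (M : InfMat K)
    (hM : M = matOfSeq a L + shiftY K) :
    (IsGradedTwistingMap (twistOfMatrix M) ↔ IsQuasiBalanced L) ∧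
    (IsGradedTwistingMatrix M ↔ IsQuasiBalanced L) ∧
    ((∃ τ : K[X] ⊗[K] K[X] →ₗ[K] K[X] ⊗[K] K[X], IsGradedTwistingMap τ ∧ HasMatrix τ M) ↔
      IsQuasiBalanced L) ∧
    (IsQuasiBalanced L →
      HasMatrix (twistOfMatrix M) M ∧
      IsTwistedTensorProduct (twistedMul (twistOfMatrix M)) ∧
      ∀ k : ℕ, twistedMul (twistOfMatrix M)
          ((1 : K[X]) ⊗ₜ[K] (Polynomial.X ^ k : K[X])) ((Polynomial.X : K[X]) ⊗ₜ[K] (1 : K[X])) =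
        ∑ j ∈ Finset.range (k + 2),
          M k j • ((Polynomial.X ^ (k + 1 - j) : K[X]) ⊗ₜ[K] (Polynomial.X ^ j : K[X]))) := by
  have ha : a + 1 ≠ 0 := fun h => ha1 (eq_neg_of_add_eq_zero_left h)
  have hess : IsHessenberg M := by
    rw [hM, matOfSeq_add_shiftY hL hpos ha]
    exact isHessenberg_weightMat
  have hbal : IsGradedTwistingMatrix M ↔ IsQuasiBalanced L :=
    hM ▸ isGradedTwistingMatrix_matOfSeq_iff hL hpos ha0 ha
  have htfae := hess.gradedTwisting_tfae
  have hmat : HasMatrix (twistOfMatrix M) M := (isTwistOf_twistOfMatrix M).hasMatrix hess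
  refine ⟨(htfae.out 0 1).trans hbal, hbal, (htfae.out 2 1).trans hbal, fun h => ⟨hmat, ?_, ?_⟩⟩
  · exact ((isTwistOf_twistOfMatrix M).isTwistingMap (hbal.2 h)).isTwistedTensorProduct
  · exact fun k => (twistedMul_one_tmul_tmul_one _ _ _).trans (hmat k)

theorem mainTheorem1 {K : Type*} [Field K] (n : ℕ) (hn : 2 ≤ n) (a : K) (ha0 : a ≠ 0)
    (ha1 : a ≠ -1) (L : ℕ → ℕ) (hL : IsDeltaSeq n L) (M : InfMat K)
    (hM : M = matOfSeq a L + shiftY K) :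
    (IsGradedTwistingMap (twistOfMatrix M) ↔ IsQuasiBalanced L) ∧
    (IsGradedTwistingMatrix M ↔ IsQuasiBalanced L) ∧
    ((∃ τ : K[X] ⊗[K] K[X] →ₗ[K] K[X] ⊗[K] K[X], IsGradedTwistingMap τ ∧ HasMatrix τ M) ↔
      IsQuasiBalanced L) ∧
    (IsQuasiBalanced L →
      HasMatrix (twistOfMatrix M) M ∧
      IsTwistedTensorProduct (twistedMul (twistOfMatrix M)) ∧
      ∀ k : ℕ, twistedMul (twistOfMatrix M)
          ((1 : K[X]) ⊗ₜ[K] (Polynomial.X ^ k : K[X])) ((Polynomial.X : K[X]) ⊗ₜ[K] (1 : K[X])) =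
        ∑ j ∈ Finset.range (k + 2),
          M k j • ((Polynomial.X ^ (k + 1 - j) : K[X]) ⊗ₜ[K] (Polynomial.X ^ j : K[X]))) :=
  mainTheorem1_general a ha0 ha1 L (fun _ hi _ _ hij => hL.strictMono (by omega) hi hij)
    (by have := hL.1; omega) M hM
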